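/- **Model.** An IPMSM has pole-pair number $n_p\ge 1$, inductances $L_d,L_q>0$, inertia $J>0$ and constants $R_s,\Phi,f\ge 0$. Put $L_0=\frac12(L_d+L_q)$, $L_1=\frac12(L_d-L_q)$, $\mathcal J=\begin{bmatrix}0&-1\\1&0\end{bmatrix}$, $Q(\theta)=\begin{bmatrix}\cos2\theta&\sin2\theta\\ \sin2\theta&-\cos2\theta\end{bmatrix}$, $L(\theta)=L_0I+L_1Q(\theta)$. On $[0,\infty)$ its state $(i_{\alpha\beta},\theta,\omega)$ satisfies $$L(\theta)\tfrac{d}{dt}i_{\alpha\beta}=\big(2n_p\omega L_1Q(\theta)\mathcal J-R_sI\big)i_{\alpha\beta}+n_p\omega\Phi\begin{bmatrix}\sin\theta\\-\cos\theta\end{bmatrix}+v_{\alpha\beta},\qquad \dot\theta=n_p\omega,\qquad J\dot\omega=n_p\Phi(i_\beta\cos\theta-i_\alpha\sin\theta)-f\omega-T_L,$$ with $v_{\alpha\beta}=v^C_{\alpha\beta}+(V_h\sin\omega_ht,\,0)^\top$, $V_h>0$, $\omega_h=2\pi/\varepsilon$. The virtual output is $$y_v=\frac1{L_dL_q}\begin{bmatrix}L_0-L_1\cos2\theta\\-L_1\sin2\theta\end{bmatrix}.$$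 **Estimator.** Let $S(t)=-\frac{V_h}{2\pi}\cos\omega_ht$. With $d=\varepsilon$ put $$Y_f(t)=i_{\alpha\beta}(t-d)-\frac1{2d}\int_{t-2d}^{t}i_{\alpha\beta}(s)\,ds ,$$ that is, $Y_f=G_d(s)[i_{\alpha\beta}]$ with $G_d(s)=e^{-ds}+\frac1{2ds}(e^{-2ds}-1)$. Let $x$ solve $\dot x=-\gamma S^2x+\gamma SY_f$ from an arbitrary starting time and initial value, and let $\hat y_v=x/\varepsilon$, that is, $\hat y_v=\mathcal G_{\tt grad}^{\gamma}\circ G_d(s)[i_{\alpha\beta}]$. **Assumptions.** There are constants $B,T,\ell_v,\ell_C$, independent of $\varepsilon$, such that for all $t\ge0$: $|i_{\alpha\beta}(t)|\le B$, $|\omega(t)|\le B$, $|\dot y_v(t)|\le\ell_v$ and $|T_L(t)|\le T$; and the control signal $v^C_{\alpha\beta}$ is Lipschitz on $[0,\infty)$ with constant $\ell_C$. **Proposition.** There are $\omega_h^\star,\gamma^\star>0$ and a nondecreasing function $C:\mathbb R\to\mathbb R$, depending only on the motor constants, $V_h,B,T,\ell_v,\ell_C$, such that for all $\omega_h>\omega_h^\star$,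 all $\gamma>\gamma^\star/\varepsilon$ and all trajectories satisfying the assumptions, $$\limsup_{t\to\infty}\big|\hat y_v(t)-y_v(t)\big|\le C(\gamma\varepsilon)\,\varepsilon ,$$ so the error is $\mathcal O(\varepsilon)$, uniformly as long as the product $\gamma\varepsilon$ stays bounded. Consequently, if $L_d<L_q$, the angle estimate $\hat\theta=\frac12\operatorname{atan2}\!\big(\hat y_{v,2},\ \hat y_{v,1}-\frac{L_0}{L_dL_q}\big)$ satisfies $$\limsup_{t\to\infty}\ \operatorname{dist}\big(\hat\theta(t)-\theta(t),\,\pi\mathbb Z\big)\le C(\gamma\varepsilon)\,\varepsilon .$$ -/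

import Mathlib

open Filter Set

noncomputable section

/-- Signals take values in the Euclidean plane; coordinate `0` is the `α` axis and coordinate `1`
the `β` axis. -/
abbrev Plane : Type := EuclideanSpace ℝ (Fin 2)

/-- The constants of an interior permanent magnet synchronous motor. -/
structure IPMSM where
  /-- number of pole pairs -/
  np : ℕ
  /-- stator resistance -/
  Rs : ℝ
  /-- magnet flux -/
  Φ : ℝ
  /-- drive inertia -/
  J : ℝ
  /-- friction constant -/
  f : ℝ
  /-- `d`-axis inductance -/
  Ld : ℝ
  /-- `q`-axis inductance -/
  Lq : ℝ
  np_pos : 0 < np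
  Rs_nonneg : 0 ≤ Rs
  Φ_nonneg : 0 ≤ Φ
  J_pos : 0 < J
  f_nonneg : 0 ≤ f
  Ld_pos : 0 < Ld
  Lq_pos : 0 < Lq

namespace IPMSM

/-- A `2 × 2` matrix acting on a vector of the plane. -/
def act (A : Matrix (Fin 2) (Fin 2) ℝ) (x : Plane) : Plane :=
  WithLp.toLp 2 (A.mulVec x.ofLp)

/-- The matrix `𝒥`. -/
def rot : Matrix (Fin 2) (Fin 2) ℝ := !![0, -1; 1, 0]

/-- The matrix `Q(θ)`. -/
def Q (θ : ℝ) : Matrix (Fin 2) (Fin 2) ℝ :=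
  !![Real.cos (2 * θ), Real.sin (2 * θ); Real.sin (2 * θ), -Real.cos (2 * θ)]

variable (M : IPMSM)

/-- Averaged inductance. -/
def L0 : ℝ := (M.Ld + M.Lq) / 2

/-- Inductance difference. -/
def L1 : ℝ := (M.Ld - M.Lq) / 2

/-- The inductance matrix `L(θ) = L₀ I + L₁ Q(θ)`. -/
def L (θ : ℝ) : Matrix (Fin 2) (Fin 2) ℝ :=
  M.L0 • (1 : Matrix (Fin 2) (Fin 2) ℝ) + M.L1 • Q θ

/-- `F(i, θ, ω) = (2 n_p ω L₁ Q(θ) 𝒥 - R_s I) i + n_p ω Φ (sin θ, -cos θ)`. -/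
def F (i : Plane) (θ ω : ℝ) : Plane :=
  act ((2 * M.np * ω * M.L1) • (Q θ * rot) - M.Rs • (1 : Matrix (Fin 2) (Fin 2) ℝ)) i
    + (M.np * ω * M.Φ) • (!₂[Real.sin θ, -Real.cos θ] : Plane)

/-- `(i, θ, ω)` solves the motor equations on `[0, ∞)` under the stator voltage `v` and the load
torque `TL`. -/
def IsSolution (TL : ℝ → ℝ) (v i : ℝ → Plane) (θ ω : ℝ → ℝ) : Prop :=
  ∀ t : ℝ, 0 ≤ t →
    (∃ di : Plane, HasDerivWithinAt i di (Ici 0) t ∧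
      act (M.L (θ t)) di = M.F (i t) (θ t) (ω t) + v t) ∧
    HasDerivWithinAt θ (M.np * ω t) (Ici 0) t ∧
    (∃ dω : ℝ, HasDerivWithinAt ω dω (Ici 0) t ∧
      M.J * dω = M.np * M.Φ * (i t 1 * Real.cos (θ t) - i t 0 * Real.sin (θ t))
        - M.f * ω t - TL t)

/-- The virtual output `y_v`, as a function of the rotor angle. -/
def virtualOutput (θ : ℝ) : Plane :=
  (1 / (M.Ld * M.Lq)) •
    (!₂[-M.L1 * Real.cos (2 * θ) + M.L0, -M.L1 * Real.sin (2 * θ)] : Plane)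

/-- The angle estimate `(1/2) atan2 (y₂, y₁ - L₀ / (L_d L_q))`. -/
def angleOf (y : Plane) : ℝ :=
  (1 / 2) * Complex.arg (⟨y 0 - M.L0 / (M.Ld * M.Lq), y 1⟩ : ℂ)

end IPMSM

/-- The period `ε = 2π / ω_h` of the injected signal. -/
def injPeriod (ωh : ℝ) : ℝ := 2 * Real.pi / ωh

/-- The injected voltage `(V_h sin (ω_h t), 0)`. -/
def injection (Vh ωh t : ℝ) : Plane := !₂[Vh * Real.sin (ωh * t), 0]

/-- `S(t) = -(V_h / 2π) cos (ω_h t)`. -/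
def sigS (Vh ωh t : ℝ) : ℝ := -(Vh / (2 * Real.pi)) * Real.cos (ωh * t)

/-- The delay operator `𝒟_d`. -/
def delayOp (d : ℝ) (u : ℝ → Plane) (t : ℝ) : Plane := u (t - d)

/-- The state `χ` of the weighted zero-order hold: `χ' = u` and `χ(0) = 0`. -/
def holdState (u : ℝ → Plane) (t : ℝ) : Plane := ∫ s in (0 : ℝ)..t, u s

/-- The weighted zero-order-hold operator `𝒵_w`. -/
def holdOp (w : ℝ) (u : ℝ → Plane) (t : ℝ) : Plane :=
  (1 / w) • (holdState u t - holdState u (t - w))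

/-- The filter `G_d = 𝒟_d - 𝒵_{2d}`. -/
def filterG (d : ℝ) (u : ℝ → Plane) (t : ℝ) : Plane := delayOp d u t - holdOp (2 * d) u t

/-- `y` is an output of the gradient operator `𝒢_grad` with gain `γ`, switched on at time `t₀` with
an arbitrary initial state and driven by `u`:
`x' = -γ S² x + γ S u` and `y = x / ε` for `t > t₀`. -/
def IsGradOutput (Vh ωh γ t₀ : ℝ) (u y : ℝ → Plane) : Prop :=
  ∃ x : ℝ → Plane, ∀ t : ℝ, t₀ < t →
    HasDerivAt x (-(γ * sigS Vh ωh t ^ 2) • x t + (γ * sigS Vh ωh t) • u t) t ∧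
    y t = (1 / injPeriod ωh) • x t

end

/-! Inverting `L(θ)` turns the current equation into `i' = g + V_h sin(ω_h t) y_v`, because `y_v` is
the first column of `L(θ)⁻¹` and the injection acts on the `α` axis. As `εS` is a primitive of the
injected voltage, expanding around `τ = t - ε` gives `i(u) = i(τ) + (u - τ) g(τ) + ε (S(u) - S(τ))
y_v(τ) + O(ε²)`. The filter subtracts from `i(τ)` the mean over `[τ - ε, τ + ε]`: the linear term
vanishes by symmetry, `S` has mean zero over two periods, and `ε S y_v + O(ε²)` remains
(`norm_filterG_sub_le`).

The estimation error then satisfies `e' = -γS² e + O(γε) + O(1)`. Since `γS²` has mean `γσ²/2` with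
`σ = V_h/2π`, the error ends up of order `ε + 1/γ`, hence `O(ε)` once `γε > 1`; the oscillation of
`∫ γS²` costs a factor exponential in `γε` (`gradient_estimate`).

The delicate point is a Lipschitz constant of `g` independent of `ω_h` (`exists_drift_lipschitz`).
It needs a bound on `v^C`, which is only assumed Lipschitz; the bound comes from the flux linkage, a
bounded quantity with derivative `-R_s i + v` (`UnifBdd.of_primitive`). -/

/-! ### Calculus of uniformly bounded and uniformly Lipschitz families -/

/-- The family of signals `f` is bounded on `[0, ∞)`, uniformly over the family. -/
def UnifBdd {ι : Type*} (f : ι → ℝ → ℝ) : Prop :=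
  ∃ b : ℝ, ∀ x, ∀ t : ℝ, 0 ≤ t → |f x t| ≤ b

/-- The family of signals `f` is Lipschitz on `[0, ∞)`, uniformly over the family. -/
def UnifLip {ι : Type*} (f : ι → ℝ → ℝ) : Prop :=
  ∃ ℓ : ℝ, ∀ x, ∀ s t : ℝ, 0 ≤ s → 0 ≤ t → |f x s - f x t| ≤ ℓ * |s - t|

namespace UnifBdd

variable {ι : Type*} {f g : ι → ℝ → ℝ}

theorem const (c : ℝ) : UnifBdd (fun (_ : ι) _ => c) := ⟨|c|, fun _ _ _ => le_rfl⟩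

theorem cos (h : ι → ℝ → ℝ) : UnifBdd (fun x t => Real.cos (h x t)) :=
  ⟨1, fun _ _ _ => Real.abs_cos_le_one _⟩

theorem sin (h : ι → ℝ → ℝ) : UnifBdd (fun x t => Real.sin (h x t)) :=
  ⟨1, fun _ _ _ => Real.abs_sin_le_one _⟩

theorem neg (hf : UnifBdd f) : UnifBdd (fun x t => -f x t) := by
  obtain ⟨b, hb⟩ := hf
  exact ⟨b, fun x t ht => by simpa using hb x t ht⟩

theorem add (hf : UnifBdd f) (hg : UnifBdd g) : UnifBdd (fun x t => f x t + g x t) := by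
  obtain ⟨b, hb⟩ := hf
  obtain ⟨c, hc⟩ := hg
  exact ⟨b + c, fun x t ht => (abs_add_le _ _).trans (add_le_add (hb x t ht) (hc x t ht))⟩

theorem sub (hf : UnifBdd f) (hg : UnifBdd g) : UnifBdd (fun x t => f x t - g x t) := by
  simpa only [sub_eq_add_neg] using hf.add hg.neg

theorem mul (hf : UnifBdd f) (hg : UnifBdd g) : UnifBdd (fun x t => f x t * g x t) := by
  obtain ⟨b, hb⟩ := hf
  obtain ⟨c, hc⟩ := hg
  refine ⟨b * c, fun x t ht => ?_⟩
  rw [abs_mul]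
  exact mul_le_mul (hb x t ht) (hc x t ht) (abs_nonneg _) ((abs_nonneg _).trans (hb x t ht))

theorem const_mul (c : ℝ) (hf : UnifBdd f) : UnifBdd (fun x t => c * f x t) := (const c).mul hf

end UnifBdd

namespace UnifLip

variable {ι : Type*} {f g : ι → ℝ → ℝ}

theorem const (c : ℝ) : UnifLip (fun (_ : ι) _ => c) := ⟨0, fun _ _ _ _ _ => by simp⟩

theorem neg (hf : UnifLip f) : UnifLip (fun x t => -f x t) := by
  obtain ⟨b, hb⟩ := hf
  refine ⟨b, fun x s t hs ht => ?_⟩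
  rw [neg_sub_neg, abs_sub_comm]
  exact hb x s t hs ht

theorem add (hf : UnifLip f) (hg : UnifLip g) : UnifLip (fun x t => f x t + g x t) := by
  obtain ⟨b, hb⟩ := hf
  obtain ⟨c, hc⟩ := hg
  refine ⟨b + c, fun x s t hs ht => ?_⟩
  rw [add_sub_add_comm, add_mul]
  exact (abs_add_le _ _).trans (add_le_add (hb x s t hs ht) (hc x s t hs ht))

theorem sub (hf : UnifLip f) (hg : UnifLip g) : UnifLip (fun x t => f x t - g x t) := by
  simpa only [sub_eq_add_neg] using hf.add hg.neg

theorem mul (hf : UnifLip f) (hg : UnifLip g) (hf' : UnifBdd f) (hg' : UnifBdd g) :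
    UnifLip (fun x t => f x t * g x t) := by
  obtain ⟨k, hk⟩ := hf
  obtain ⟨l, hl⟩ := hg
  obtain ⟨b, hb⟩ := hf'
  obtain ⟨c, hc⟩ := hg'
  refine ⟨b * l + k * c, fun x s t hs ht => ?_⟩
  calc |f x s * g x s - f x t * g x t|
      = |f x s * (g x s - g x t) + (f x s - f x t) * g x t| := by ring_nf
    _ ≤ |f x s| * |g x s - g x t| + |f x s - f x t| * |g x t| := by
        rw [← abs_mul, ← abs_mul]; exact abs_add_le _ _
    _ ≤ b * (l * |s - t|) + (k * |s - t|) * c := by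
        have h1 := hb x s hs
        have h2 := hk x s t hs ht
        exact add_le_add
          (mul_le_mul h1 (hl x s t hs ht) (abs_nonneg _) ((abs_nonneg _).trans h1))
          (mul_le_mul h2 (hc x t ht) (abs_nonneg _) ((abs_nonneg _).trans h2))
    _ = (b * l + k * c) * |s - t| := by ring

theorem const_mul (c : ℝ) (hf : UnifLip f) : UnifLip (fun x t => c * f x t) := by
  obtain ⟨b, hb⟩ := hf
  refine ⟨|c| * b, fun x s t hs ht => ?_⟩
  rw [← mul_sub, abs_mul, mul_assoc]
  exact mul_le_mul_of_nonneg_left (hb x s t hs ht) (abs_nonneg _)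

theorem of_deriv {f' : ι → ℝ → ℝ} (hf' : UnifBdd f')
    (h : ∀ x, ∀ t : ℝ, 0 ≤ t → HasDerivWithinAt (f x) (f' x t) (Ici 0) t) : UnifLip f := by
  obtain ⟨b, hb⟩ := hf'
  refine ⟨b, fun x s t hs ht => ?_⟩
  simpa [Real.norm_eq_abs] using (convex_Ici (0 : ℝ)).norm_image_sub_le_of_norm_hasDerivWithin_le
    (fun u hu => h x u hu) (fun u hu => by simpa using hb x u hu) ht hs

end UnifLip

/-- If a bounded signal has derivative `a + v` with `a` bounded and `v` Lipschitz, then `v` is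
bounded. -/
theorem UnifBdd.of_primitive {ι : Type*} {ψ a v : ι → ℝ → ℝ} (hψ : UnifBdd ψ) (ha : UnifBdd a)
    (hv : UnifLip v)
    (h : ∀ x, ∀ t : ℝ, 0 ≤ t → HasDerivWithinAt (ψ x) (a x t + v x t) (Ici 0) t) :
    UnifBdd v := by
  obtain ⟨b, hb⟩ := hψ
  obtain ⟨c, hc⟩ := ha
  obtain ⟨ℓ, hℓ⟩ := hv
  -- On `[t, t + 1]` the signal `v` stays within `|ℓ|` of `v t`, so `v t` differs from `ψ (t + 1) -
  -- ψ t` by at most `c + |ℓ|`.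
  refine ⟨c + |ℓ| + 2 * b, fun x t ht => ?_⟩
  have hd : ∀ u ∈ Icc t (t + 1),
      HasDerivWithinAt (fun u => ψ x u - (u - t) * v x t) (a x u + v x u - 1 * v x t)
        (Icc t (t + 1)) u := by
    intro u hu
    exact ((h x u (ht.trans hu.1)).mono (fun w hw => ht.trans hw.1)).sub
      (((hasDerivWithinAt_id u _).sub_const t).mul_const _)
  have hbd : ∀ u ∈ Icc t (t + 1), ‖a x u + v x u - 1 * v x t‖ ≤ c + |ℓ| := by
    intro u hu
    have h0 : 0 ≤ u := ht.trans hu.1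
    have h1 : |v x u - v x t| ≤ |ℓ| := by
      refine (hℓ x u t h0 ht).trans ?_
      have h2 : |u - t| ≤ 1 := by rw [abs_le]; constructor <;> linarith [hu.1, hu.2]
      calc ℓ * |u - t| ≤ |ℓ| * |u - t| :=
            mul_le_mul_of_nonneg_right (le_abs_self _) (abs_nonneg _)
        _ ≤ |ℓ| * 1 := mul_le_mul_of_nonneg_left h2 (abs_nonneg _)
        _ = |ℓ| := mul_one _
    rw [one_mul, add_sub_assoc, Real.norm_eq_abs]
    exact (abs_add_le _ _).trans (add_le_add (hc x u h0) h1)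
  have key := (convex_Icc t (t + 1)).norm_image_sub_le_of_norm_hasDerivWithin_le hd hbd
    (left_mem_Icc.2 (by linarith)) (right_mem_Icc.2 (by linarith))
  have h1 := abs_le.1 (hb x t ht)
  have h2 := abs_le.1 (hb x (t + 1) (by linarith))
  simp only [add_sub_cancel_left, sub_self, zero_mul, sub_zero, one_mul, norm_one, mul_one,
    Real.norm_eq_abs] at key
  have h3 := abs_le.1 key
  rw [abs_le]
  constructor <;> linarith [h1.1, h1.2, h2.1, h2.2, h3.1, h3.2]

/-! ### The injected signal and the filter -/

theorem injPeriod_pos {ωh : ℝ} (h : 0 < ωh) : 0 < injPeriod ωh := by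
  unfold injPeriod; positivity

theorem sigS_sub_injPeriod {Vh ωh : ℝ} (h : 0 < ωh) (t : ℝ) :
    sigS Vh ωh (t - injPeriod ωh) = sigS Vh ωh t := by
  unfold sigS injPeriod
  rw [mul_sub, mul_div_cancel₀ _ h.ne', Real.cos_sub_two_pi]

theorem abs_sigS_le {Vh : ℝ} (hV : 0 ≤ Vh) (ωh t : ℝ) :
    |sigS Vh ωh t| ≤ Vh / (2 * Real.pi) := by
  unfold sigS
  rw [abs_mul, abs_neg, abs_of_nonneg (by positivity)]
  exact mul_le_of_le_one_right (by positivity) (Real.abs_cos_le_one _)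

theorem hasDerivAt_injPeriod_mul_sigS {Vh ωh : ℝ} (h : 0 < ωh) (t : ℝ) :
    HasDerivAt (fun u => injPeriod ωh * sigS Vh ωh u) (Vh * Real.sin (ωh * t)) t := by
  have h1 : HasDerivAt (fun u : ℝ => ωh * u) ωh t := by
    simpa using (hasDerivAt_id t).const_mul ωh
  have h2 := (h1.cos.const_mul (-(Vh / (2 * Real.pi)))).const_mul (injPeriod ωh)
  refine h2.congr_deriv ?_
  unfold injPeriod
  field_simp

theorem continuous_sigS (Vh ωh : ℝ) : Continuous (sigS Vh ωh) := by
  unfold sigS; fun_prop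

theorem integral_sigS {Vh ωh : ℝ} (h : 0 < ωh) (τ : ℝ) :
    ∫ u in (τ - injPeriod ωh)..(τ + injPeriod ωh), sigS Vh ωh u = 0 := by
  have h1 : ∀ u, HasDerivAt (fun u => -(Vh / (2 * Real.pi)) * (Real.sin (ωh * u) / ωh))
      (sigS Vh ωh u) u := by
    intro u
    have h1 : HasDerivAt (fun u : ℝ => ωh * u) ωh u := by
      simpa using (hasDerivAt_id u).const_mul ωh
    refine ((h1.sin.div_const ωh).const_mul (-(Vh / (2 * Real.pi)))).congr_deriv ?_
    unfold sigS
    field_simp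
  rw [intervalIntegral.integral_eq_sub_of_hasDerivAt (fun u _ => h1 u)
    ((continuous_sigS Vh ωh).intervalIntegrable _ _)]
  unfold injPeriod
  rw [mul_sub, mul_add, mul_div_cancel₀ _ h.ne', Real.sin_add_two_pi, Real.sin_sub_two_pi, sub_self]

theorem integral_centered (τ ε : ℝ) : ∫ u in (τ - ε)..(τ + ε), (u - τ) = 0 := by
  rw [intervalIntegral.integral_sub (by simp) (by simp)]
  simp
  ring

/-- The averaging window is centred at the delayed time `t - d`, which is the purpose of the delay.
The condition `2 * d ≤ t` keeps the window inside `[0, ∞)`, where `u` is continuous. -/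
theorem filterG_eq {d : ℝ} {u : ℝ → Plane} (hu : ContinuousOn u (Ici 0)) (hd : 0 ≤ d) {t : ℝ}
    (ht : 2 * d ≤ t) :
    filterG d u t = u (t - d) - (1 / (2 * d)) • ∫ s in (t - d - d)..(t - d + d), u s := by
  have hint : ∀ a : ℝ, 0 ≤ a → IntervalIntegrable u MeasureTheory.volume 0 a := fun a ha =>
    (hu.mono (by rw [uIcc_of_le ha]; exact Icc_subset_Ici_self)).intervalIntegrable
  unfold filterG delayOp holdOp holdState
  rw [intervalIntegral.integral_interval_sub_left (hint t (by linarith))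
    (hint (t - 2 * d) (by linarith)), sub_add_cancel, sub_sub, ← two_mul]

/-- The filter `G_ε` extracts `ε S y` from a current whose derivative is a Lipschitz signal `g`
plus the injected voltage times a Lipschitz signal `y`, up to an error of order `ε²`. -/
theorem norm_filterG_sub_le {Vh ωh k ℓ : ℝ} (hV : 0 ≤ Vh) (hω : 0 < ωh)
    {i g y : ℝ → Plane}
    (hi : ∀ t : ℝ, 0 ≤ t →
      HasDerivWithinAt i (g t + (Vh * Real.sin (ωh * t)) • y t) (Ici 0) t)
    (hk : 0 ≤ k) (hℓ : 0 ≤ ℓ)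
    (hg : ∀ s t : ℝ, 0 ≤ s → 0 ≤ t → ‖g s - g t‖ ≤ k * |s - t|)
    (hy : ∀ s t : ℝ, 0 ≤ s → 0 ≤ t → ‖y s - y t‖ ≤ ℓ * |s - t|)
    {t : ℝ} (ht : 2 * injPeriod ωh ≤ t) :
    ‖filterG (injPeriod ωh) i t - (injPeriod ωh * sigS Vh ωh t) • y t‖
      ≤ (k + Vh * ℓ + Vh / (2 * Real.pi) * ℓ) * injPeriod ωh ^ 2 := by
  have hic : ContinuousOn i (Ici 0) := fun t ht => (hi t ht).continuousWithinAt
  have hε := injPeriod_pos hω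
  rw [filterG_eq hic hε.le ht, ← sigS_sub_injPeriod hω t]
  have hder := hasDerivAt_injPeriod_mul_sigS (Vh := Vh) hω
  have hSint := integral_sigS (Vh := Vh) hω (t - injPeriod ωh)
  have hSb := abs_sigS_le hV ωh (t - injPeriod ωh)
  set ε := injPeriod ωh
  set τ := t - ε with hτ
  have hsub : Icc (τ - ε) (τ + ε) ⊆ Ici 0 := fun u hu => by
    have : τ - ε ≤ u := hu.1
    simp only [mem_Ici]; linarith
  have hτ0 : 0 ≤ τ := by linarith
  have hτm : τ ∈ Icc (τ - ε) (τ + ε) := ⟨by linarith, by linarith⟩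
  have hdist : ∀ u ∈ Icc (τ - ε) (τ + ε), |u - τ| ≤ ε := fun u hu => by
    rw [abs_le]; constructor <;> linarith [hu.1, hu.2]
  -- Remainder of the expansion at `τ`, with the injected part integrated exactly. Its derivative is
  -- `O(ε)` by the Lipschitz bounds, so it is `O(ε²)` on the window.
  set R : ℝ → Plane := fun u =>
    i u - i τ - (u - τ) • g τ - (ε * sigS Vh ωh u - ε * sigS Vh ωh τ) • y τ with hR
  have hRd : ∀ u ∈ Icc (τ - ε) (τ + ε), HasDerivWithinAt R
      ((g u + (Vh * Real.sin (ωh * u)) • y u) - (1 : ℝ) • g τ - (Vh * Real.sin (ωh * u)) • y τ)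
      (Icc (τ - ε) (τ + ε)) u := by
    intro u hu
    exact ((((hi u (hsub hu)).mono hsub).sub_const _).sub
      (((hasDerivWithinAt_id u _).sub_const τ).smul_const (g τ))).sub
      (((hder u).hasDerivWithinAt.sub_const _).smul_const (y τ))
  have hRb : ∀ u ∈ Icc (τ - ε) (τ + ε),
      ‖(g u + (Vh * Real.sin (ωh * u)) • y u) - (1 : ℝ) • g τ - (Vh * Real.sin (ωh * u)) • y τ‖
        ≤ (k + Vh * ℓ) * ε := by
    intro u hu
    have e1 : (g u + (Vh * Real.sin (ωh * u)) • y u) - (1 : ℝ) • g τ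
        - (Vh * Real.sin (ωh * u)) • y τ
        = (g u - g τ) + (Vh * Real.sin (ωh * u)) • (y u - y τ) := by
      rw [one_smul, smul_sub]; abel
    have h1 : ‖g u - g τ‖ ≤ k * ε :=
      (hg u τ (hsub hu) hτ0).trans (mul_le_mul_of_nonneg_left (hdist u hu) hk)
    have h2 : ‖y u - y τ‖ ≤ ℓ * ε :=
      (hy u τ (hsub hu) hτ0).trans (mul_le_mul_of_nonneg_left (hdist u hu) hℓ)
    have h3 : ‖Vh * Real.sin (ωh * u)‖ ≤ Vh := by
      rw [norm_mul, Real.norm_of_nonneg hV]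
      exact mul_le_of_le_one_right hV (Real.abs_sin_le_one _)
    rw [e1]
    calc _ ≤ ‖g u - g τ‖ + ‖Vh * Real.sin (ωh * u)‖ * ‖y u - y τ‖ := by
          rw [← norm_smul]; exact norm_add_le _ _
      _ ≤ k * ε + Vh * (ℓ * ε) := add_le_add h1 (mul_le_mul h3 h2 (norm_nonneg _) hV)
      _ = _ := by ring
  have hRn : ∀ u ∈ Icc (τ - ε) (τ + ε), ‖R u‖ ≤ (k + Vh * ℓ) * ε ^ 2 := by
    intro u hu
    have h1 := (convex_Icc (τ - ε) (τ + ε)).norm_image_sub_le_of_norm_hasDerivWithin_le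
      hRd hRb hτm hu
    have h0 : R τ = 0 := by simp [hR]
    rw [h0, sub_zero] at h1
    refine h1.trans ?_
    rw [pow_two, ← mul_assoc]
    exact mul_le_mul_of_nonneg_left (hdist u hu) (by positivity)
  have hle : τ - ε ≤ τ + ε := by linarith
  have hiI : IntervalIntegrable i MeasureTheory.volume (τ - ε) (τ + ε) :=
    (hic.mono (by rw [uIcc_of_le hle]; exact hsub)).intervalIntegrable
  have hI1 : IntervalIntegrable (fun u : ℝ => (u - τ) • g τ) MeasureTheory.volume
      (τ - ε) (τ + ε) := Continuous.intervalIntegrable (by fun_prop) _ _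
  have hI2 : IntervalIntegrable
      (fun u : ℝ => (ε * sigS Vh ωh u - ε * sigS Vh ωh τ) • y τ) MeasureTheory.volume
      (τ - ε) (τ + ε) := by
    have := continuous_sigS Vh ωh
    exact Continuous.intervalIntegrable (by fun_prop) _ _
  -- Only the terms constant in `u` survive, by `integral_centered` and `integral_sigS`.
  have hRI : ∫ u in (τ - ε)..(τ + ε), R u
      = (∫ u in (τ - ε)..(τ + ε), i u) - (2 * ε) • i τ
        + (2 * ε * (ε * sigS Vh ωh τ)) • y τ := by
    rw [hR, intervalIntegral.integral_sub ((hiI.sub intervalIntegrable_const).sub hI1) hI2,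
      intervalIntegral.integral_sub (hiI.sub intervalIntegrable_const) hI1,
      intervalIntegral.integral_sub hiI intervalIntegrable_const,
      intervalIntegral.integral_smul_const, intervalIntegral.integral_smul_const,
      integral_centered, intervalIntegral.integral_sub
        (((continuous_sigS Vh ωh).const_mul ε).intervalIntegrable _ _) intervalIntegrable_const,
      intervalIntegral.integral_const_mul, hSint, intervalIntegral.integral_const,
      intervalIntegral.integral_const]
    have : τ + ε - (τ - ε) = 2 * ε := by ring
    rw [this]
    simp only [zero_smul, sub_zero, mul_zero, zero_sub, smul_eq_mul, neg_smul, sub_neg_eq_add]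
  have hRIn : ‖∫ u in (τ - ε)..(τ + ε), R u‖ ≤ (k + Vh * ℓ) * ε ^ 2 * (2 * ε) := by
    have h1 := intervalIntegral.norm_integral_le_of_norm_le_const (f := R) (a := τ - ε)
      (b := τ + ε) (C := (k + Vh * ℓ) * ε ^ 2) (fun u hu => hRn u (by
        rw [uIoc_of_le hle] at hu; exact Ioc_subset_Icc_self hu))
    have : τ + ε - (τ - ε) = 2 * ε := by ring
    rwa [this, abs_of_pos (by positivity)] at h1
  have hdec : i τ - (1 / (2 * ε)) • (∫ u in (τ - ε)..(τ + ε), i u) - (ε * sigS Vh ωh τ) • y t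
      = -((1 / (2 * ε)) • ∫ u in (τ - ε)..(τ + ε), R u)
        + (ε * sigS Vh ωh τ) • (y τ - y t) := by
    have e1 : 1 / (2 * ε) * (2 * ε) = 1 := one_div_mul_cancel (by positivity)
    rw [hRI, smul_add, smul_sub, smul_smul, smul_smul,
      ← mul_assoc (1 / (2 * ε)) (2 * ε) (ε * sigS Vh ωh τ), e1, one_mul, one_smul, smul_sub]
    abel
  rw [hdec]
  -- Undoing the delay in `y` gives the summand `Vh / (2 * π) * ℓ`; `S` needs no correction, being
  -- `ε`-periodic.
  have hyt : ‖y τ - y t‖ ≤ ℓ * ε := by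
    have h1 := hy τ t hτ0 (by linarith)
    have h2 : τ - t = -ε := by rw [hτ]; ring
    rwa [h2, abs_neg, abs_of_pos hε] at h1
  calc _ ≤ 1 / (2 * ε) * ‖∫ u in (τ - ε)..(τ + ε), R u‖
        + (ε * |sigS Vh ωh τ|) * ‖y τ - y t‖ := by
        refine (norm_add_le _ _).trans (le_of_eq ?_)
        rw [norm_neg, norm_smul, norm_smul, Real.norm_of_nonneg (by positivity), norm_mul,
          Real.norm_of_nonneg hε.le, Real.norm_eq_abs]
    _ ≤ 1 / (2 * ε) * ((k + Vh * ℓ) * ε ^ 2 * (2 * ε))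
        + (ε * (Vh / (2 * Real.pi))) * (ℓ * ε) := by
        gcongr
    _ = _ := by field_simp

/-! ### The gradient estimator -/

/-- Solutions of `e' = -a e + w`, where `a ≥ 0` has mean `k`, forget their initial value. -/
theorem exists_norm_le_exp_add {E : Type*} [NormedAddCommGroup E] [NormedSpace ℝ E]
    {a A : ℝ → ℝ} {e w : ℝ → E} {k κ W t₁ : ℝ} (hk : 0 < k)
    (hA : ∀ t, HasDerivAt A (a t) t) (hAk : ∀ t, |A t - k * t| ≤ κ)
    (he : ∀ t, t₁ ≤ t → HasDerivAt e (-(a t) • e t + w t) t) (hw : ∀ t, t₁ ≤ t → ‖w t‖ ≤ W) :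
    ∃ c : ℝ, ∀ t, t₁ ≤ t → ‖e t‖ ≤ c * Real.exp (-(k * t)) + Real.exp (2 * κ) * (W / k) := by
  have hW : 0 ≤ W := (norm_nonneg _).trans (hw t₁ le_rfl)
  -- Integrating factor: the derivative of `exp A • e` no longer contains `e`. Comparing `A` with `k
  -- * t` costs `exp κ` in the integral and again on dividing by `exp A`, hence `exp (2 * κ)`.
  set E₁ : ℝ → E := fun t => Real.exp (A t) • e t with hE
  have hEd : ∀ t, t₁ ≤ t → HasDerivAt E₁ (Real.exp (A t) • w t) t := by
    intro t ht
    refine ((hA t).exp.smul (he t ht)).congr_deriv ?_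
    rw [smul_add, smul_smul, add_right_comm, ← add_smul]
    have : Real.exp (A t) * -a t + Real.exp (A t) * a t = 0 := by ring
    rw [this, zero_smul, zero_add]
  have hmain : ∀ t, t₁ ≤ t →
      ‖E₁ t‖ ≤ ‖E₁ t₁‖ + Real.exp κ * (W / k) * (Real.exp (k * t) - Real.exp (k * t₁)) := by
    intro t ht
    refine image_norm_le_of_norm_deriv_right_le_deriv_boundary (a := t₁) (b := t)
      (f' := fun t => Real.exp (A t) • w t)
      (B := fun t => ‖E₁ t₁‖ + Real.exp κ * (W / k) * (Real.exp (k * t) - Real.exp (k * t₁)))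
      (B' := fun t => Real.exp κ * (W / k) * (Real.exp (k * t) * k))
      (fun u hu => (hEd u hu.1).continuousAt.continuousWithinAt)
      (fun u hu => (hEd u hu.1).hasDerivWithinAt) (by simp) ?_ ?_ ⟨ht, le_rfl⟩
    · intro u
      have h1 : HasDerivAt (fun u : ℝ => k * u) k u := by
        simpa using (hasDerivAt_id u).const_mul k
      exact ((h1.exp.sub_const _).const_mul _).const_add _
    · intro u hu
      rw [norm_smul, Real.norm_of_nonneg (Real.exp_pos _).le]
      have h1 : Real.exp (A u) ≤ Real.exp κ * Real.exp (k * u) := by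
        rw [← Real.exp_add]
        exact Real.exp_le_exp.2 (by linarith [(abs_le.1 (hAk u)).2])
      calc Real.exp (A u) * ‖w u‖ ≤ (Real.exp κ * Real.exp (k * u)) * W :=
            mul_le_mul h1 (hw u hu.1) (norm_nonneg _) (by positivity)
        _ = _ := by field_simp
  refine ⟨Real.exp κ * ‖E₁ t₁‖, fun t ht => ?_⟩
  have h1 : ‖e t‖ = Real.exp (-A t) * ‖E₁ t‖ := by
    rw [hE, norm_smul, Real.norm_of_nonneg (Real.exp_pos _).le, ← mul_assoc, ← Real.exp_add,
      neg_add_cancel, Real.exp_zero, one_mul]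
  have h2 : Real.exp (-A t) ≤ Real.exp κ * Real.exp (-(k * t)) := by
    rw [← Real.exp_add]
    exact Real.exp_le_exp.2 (by linarith [(abs_le.1 (hAk t)).1])
  have h3 : ‖E₁ t‖ ≤ ‖E₁ t₁‖ + Real.exp κ * (W / k) * Real.exp (k * t) := by
    refine (hmain t ht).trans ?_
    have := Real.exp_pos (k * t₁)
    gcongr
    linarith
  rw [h1]
  refine (mul_le_mul h2 h3 (norm_nonneg _) (by positivity)).trans (le_of_eq ?_)
  have h4 : Real.exp (2 * κ) = Real.exp κ * Real.exp κ := by rw [← Real.exp_add]; ring_nf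
  have h5 : Real.exp (-(k * t)) * Real.exp (k * t) = 1 := by
    rw [← Real.exp_add, neg_add_cancel, Real.exp_zero]
  rw [h4]
  linear_combination (Real.exp κ * Real.exp κ * (W / k)) * h5

/-- Convergence of the gradient estimator for an input `u` close to `ε S y`. -/
theorem gradient_estimate {Vh ωh γ ℓ K t₁ : ℝ} (hV : 0 < Vh) (hω : 0 < ωh) (hγ : 0 < γ)
    {x u y y' : ℝ → Plane}
    (hx : ∀ t, t₁ ≤ t →
      HasDerivAt x (-(γ * sigS Vh ωh t ^ 2) • x t + (γ * sigS Vh ωh t) • u t) t)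
    (hy : ∀ t, t₁ ≤ t → HasDerivAt y (y' t) t) (hy' : ∀ t, t₁ ≤ t → ‖y' t‖ ≤ ℓ)
    (hu : ∀ t, t₁ ≤ t →
      ‖u t - (injPeriod ωh * sigS Vh ωh t) • y t‖ ≤ K * injPeriod ωh ^ 2) :
    ∃ c k : ℝ, 0 < k ∧ ∀ t, t₁ ≤ t → ‖(1 / injPeriod ωh) • x t - y t‖ ≤
      c * Real.exp (-(k * t)) +
        Real.exp (γ * injPeriod ωh * (Vh / (2 * Real.pi)) ^ 2 / (4 * Real.pi)) *
          (2 / (Vh / (2 * Real.pi)) ^ 2 *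
            (Vh / (2 * Real.pi) * K * injPeriod ωh + ℓ / γ)) := by
  have hε : 0 < injPeriod ωh := injPeriod_pos hω
  have hεd : injPeriod ωh = 2 * Real.pi / ωh := rfl
  have hSd : ∀ t, sigS Vh ωh t = -(Vh / (2 * Real.pi)) * Real.cos (ωh * t) := fun _ => rfl
  set ε := injPeriod ωh
  have hσ : 0 < Vh / (2 * Real.pi) := by positivity
  set σ := Vh / (2 * Real.pi)
  have hA : ∀ t : ℝ, HasDerivAt
      (fun t => γ * σ ^ 2 * (t / 2 + Real.sin (2 * ωh * t) / (4 * ωh)))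
      (γ * sigS Vh ωh t ^ 2) t := by
    intro t
    have h1 : HasDerivAt (fun u : ℝ => 2 * ωh * u) (2 * ωh) t := by
      simpa using (hasDerivAt_id t).const_mul (2 * ωh)
    refine ((((hasDerivAt_id t).div_const 2).add
      (h1.sin.div_const (4 * ωh))).const_mul (γ * σ ^ 2)).congr_deriv ?_
    rw [hSd, mul_assoc 2 ωh t, Real.cos_two_mul]
    field_simp
    ring
  -- The deviation has amplitude `γσ²/(4ω_h)`, which depends on the gain and the frequency only
  -- through `γε`.
  have hAk : ∀ t : ℝ, |γ * σ ^ 2 * (t / 2 + Real.sin (2 * ωh * t) / (4 * ωh))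
      - γ * σ ^ 2 / 2 * t| ≤ γ * ε * σ ^ 2 / (8 * Real.pi) := by
    intro t
    have h1 : γ * σ ^ 2 * (t / 2 + Real.sin (2 * ωh * t) / (4 * ωh)) - γ * σ ^ 2 / 2 * t
        = γ * ε * σ ^ 2 / (8 * Real.pi) * Real.sin (2 * ωh * t) := by
      rw [hεd]
      field_simp
      ring
    rw [h1, abs_mul, abs_of_pos (by positivity)]
    exact mul_le_of_le_one_right (by positivity) (Real.abs_sin_le_one _)
  -- Writing `u = εS y + (u - εS y)`, the first part contributes `γS² y`, exactly what completes
  -- `-γS² (x/ε)` to `-γS² e`.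
  have he : ∀ t, t₁ ≤ t → HasDerivAt (fun t => (1 / ε) • x t - y t)
      (-(γ * sigS Vh ωh t ^ 2) • ((1 / ε) • x t - y t)
        + ((γ * sigS Vh ωh t / ε) • (u t - (ε * sigS Vh ωh t) • y t) - y' t)) t := by
    intro t ht
    refine (((hx t ht).const_smul (1 / ε)).sub (hy t ht)).congr_deriv ?_
    have e1 : γ * sigS Vh ωh t / ε * (ε * sigS Vh ωh t) = γ * sigS Vh ωh t ^ 2 := by
      field_simp
    rw [smul_sub (γ * sigS Vh ωh t / ε), smul_smul, e1]
    module
  have hw : ∀ t, t₁ ≤ t →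
      ‖(γ * sigS Vh ωh t / ε) • (u t - (ε * sigS Vh ωh t) • y t) - y' t‖
        ≤ γ * σ * K * ε + ℓ := by
    intro t ht
    have hS : |sigS Vh ωh t| ≤ σ := abs_sigS_le hV.le ωh t
    have hS' : ‖γ * sigS Vh ωh t / ε‖ ≤ γ * σ / ε := by
      rw [norm_div, norm_mul, Real.norm_of_nonneg hγ.le, Real.norm_of_nonneg hε.le,
        Real.norm_eq_abs]
      gcongr
    refine (norm_sub_le _ _).trans (add_le_add ?_ (hy' t ht))
    rw [norm_smul]
    refine (mul_le_mul hS' (hu t ht) (norm_nonneg _) (by positivity)).trans (le_of_eq ?_)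
    field_simp
  obtain ⟨c, hc⟩ := exists_norm_le_exp_add (k := γ * σ ^ 2 / 2) (by positivity) hA hAk he hw
  refine ⟨c, γ * σ ^ 2 / 2, by positivity, fun t ht => (hc t ht).trans (le_of_eq ?_)⟩
  have e1 : 2 * (γ * ε * σ ^ 2 / (8 * Real.pi)) = γ * ε * σ ^ 2 / (4 * Real.pi) := by ring
  have e2 : (γ * σ * K * ε + ℓ) / (γ * σ ^ 2 / 2) = 2 / σ ^ 2 * (σ * K * ε + ℓ / γ) := by
    field_simp
  rw [e1, e2]

theorem limsup_enorm_le_of_exp {E : Type*} [NormedAddCommGroup E] {f : ℝ → E} {c k b t₁ : ℝ}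
    (hk : 0 < k) (h : ∀ t, t₁ ≤ t → ‖f t‖ ≤ c * Real.exp (-(k * t)) + b) :
    Filter.limsup (fun t => ‖f t‖ₑ) Filter.atTop ≤ ENNReal.ofReal b := by
  have h1 : Tendsto (fun t : ℝ => c * Real.exp (-(k * t)) + b) atTop (nhds (c * 0 + b)) :=
    ((Real.tendsto_exp_neg_atTop_nhds_zero.comp
      (tendsto_id.const_mul_atTop hk)).const_mul c).add_const b
  rw [mul_zero, zero_add] at h1
  rw [← (ENNReal.tendsto_ofReal h1).limsup_eq]
  refine limsup_le_limsup ?_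
  filter_upwards [eventually_ge_atTop t₁] with t ht
  rw [← ofReal_norm]
  exact ENNReal.ofReal_le_ofReal (h t ht)

/-! ### From the virtual output to the angle -/

/-- The angle of a planar vector is a Lipschitz function of the vector, modulo `π`. -/
theorem IPMSM.norm_angleOf_sub_le (M : IPMSM) (h : M.Ld < M.Lq) (y : Plane) (θ : ℝ) :
    ‖((M.angleOf y - θ : ℝ) : AddCircle Real.pi)‖
      ≤ Real.pi / (2 * (-M.L1 / (M.Ld * M.Lq))) * ‖y - M.virtualOutput θ‖ := by
  have hLd := M.Ld_pos
  have hLq := M.Lq_pos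
  have hρ : 0 < -M.L1 / (M.Ld * M.Lq) := by
    have : 0 < -M.L1 := by unfold IPMSM.L1; linarith
    positivity
  set ρ := -M.L1 / (M.Ld * M.Lq) with hρd
  set z : ℂ := ⟨y 0 - M.L0 / (M.Ld * M.Lq), y 1⟩ with hz
  set x := M.angleOf y - θ with hx
  have hφ : Complex.arg z = 2 * x + 2 * θ := by
    rw [hx, IPMSM.angleOf]; ring
  have hsq : ‖y - M.virtualOutput θ‖ ^ 2
      = (z.re - ρ * Real.cos (2 * θ)) ^ 2 + (z.im - ρ * Real.sin (2 * θ)) ^ 2 := by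
    rw [EuclideanSpace.real_norm_sq_eq, Fin.sum_univ_two]
    simp only [IPMSM.virtualOutput, PiLp.sub_apply, PiLp.smul_apply, smul_eq_mul, hz, hρd]
    simp
    ring
  -- The distance from `ρ exp(2iθ)` to the ray through `z`, at angle `2x` from it, is `ρ |sin 2x|`
  -- if `cos 2x ≥ 0` and `ρ` otherwise; both are at least `ρ |sin x|`. The two cases below are
  -- these. The computation also covers `z = 0`, whatever the value of `arg`.
  have hsin : ρ * |Real.sin x| ≤ ‖y - M.virtualOutput θ‖ := by
    refine abs_le_of_sq_le_sq' ?_ (norm_nonneg _) |>.2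
    rw [hsq, ← Complex.norm_mul_cos_arg z, ← Complex.norm_mul_sin_arg z, hφ, mul_pow, sq_abs]
    have hm : 0 ≤ ‖z‖ := norm_nonneg z
    have e1 : (‖z‖ * Real.cos (2 * x + 2 * θ) - ρ * Real.cos (2 * θ)) ^ 2
        + (‖z‖ * Real.sin (2 * x + 2 * θ) - ρ * Real.sin (2 * θ)) ^ 2
        = ‖z‖ ^ 2 - 2 * ‖z‖ * ρ * Real.cos (2 * x) + ρ ^ 2 := by
      have h1 := Real.sin_sq_add_cos_sq (2 * x + 2 * θ)
      have h2 := Real.sin_sq_add_cos_sq (2 * θ)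
      have h3 : Real.cos (2 * x) = Real.cos (2 * x + 2 * θ) * Real.cos (2 * θ)
          + Real.sin (2 * x + 2 * θ) * Real.sin (2 * θ) := by
        rw [← Real.cos_sub, add_sub_cancel_right]
      rw [h3]
      linear_combination ‖z‖ ^ 2 * h1 + ρ ^ 2 * h2
    have e2 : Real.cos (2 * x) = 1 - 2 * Real.sin x ^ 2 := by
      rw [Real.cos_two_mul, Real.cos_sq']; ring
    rw [e1, e2]
    have hs0 := sq_nonneg (Real.sin x)
    have hs1 := Real.sin_sq_le_one x
    generalize Real.sin x ^ 2 = s at *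
    rcases le_total s (1 / 2) with hs | hs
    · have : 0 ≤ ρ ^ 2 * (s * (3 - 4 * s)) :=
        mul_nonneg (sq_nonneg _) (mul_nonneg hs0 (by linarith))
      nlinarith [sq_nonneg (‖z‖ - ρ * (1 - 2 * s))]
    · have h1 : 0 ≤ ‖z‖ * ρ * (2 * s - 1) := mul_nonneg (by positivity) (by linarith)
      have h2 : 0 ≤ ρ ^ 2 * (1 - s) := mul_nonneg (sq_nonneg _) (by linarith)
      nlinarith [sq_nonneg ‖z‖]
  -- `|sin|` has period `π`, so `x` may be replaced by its representative in `[-π/2, π/2]`, where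
  -- Jordan's inequality applies.
  have hr : ‖(x : AddCircle Real.pi)‖ ≤ Real.pi / 2 * |Real.sin x| := by
    have h1 := AddCircle.norm_le_half_period Real.pi (x := (x : AddCircle Real.pi))
      Real.pi_ne_zero
    rw [abs_of_pos Real.pi_pos] at h1
    rw [AddCircle.norm_eq] at h1 ⊢
    have h2 := Real.mul_abs_le_abs_sin h1
    rw [Real.sin_sub_int_mul_pi, abs_mul, abs_neg_one_zpow, one_mul] at h2
    have hpi := Real.pi_pos
    calc _ = Real.pi / 2 * (2 / Real.pi * |x - round (Real.pi⁻¹ * x) * Real.pi|) := by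
          field_simp
      _ ≤ _ := by gcongr
  refine hr.trans ?_
  have hpi := Real.pi_pos
  calc Real.pi / 2 * |Real.sin x| = Real.pi / (2 * ρ) * (ρ * |Real.sin x|) := by field_simp
    _ ≤ _ := by gcongr

/-! ### Uniform Lipschitz bounds along motor trajectories -/

theorem Plane.norm_le (v : Plane) : ‖v‖ ≤ |v 0| + |v 1| := by
  refine abs_le_of_sq_le_sq' ?_ (by positivity) |>.2
  rw [EuclideanSpace.real_norm_sq_eq, Fin.sum_univ_two, ← sq_abs (v 0), ← sq_abs (v 1)]
  nlinarith [abs_nonneg (v 0), abs_nonneg (v 1)]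

theorem Plane.abs_apply_le (v : Plane) (j : Fin 2) : |v j| ≤ ‖v‖ := by
  simpa using PiLp.norm_apply_le v j

theorem Plane.hasDerivWithinAt_iff {f : ℝ → Plane} {f' : Plane} {s : Set ℝ} {t : ℝ} :
    HasDerivWithinAt f f' s t ↔
      HasDerivWithinAt (fun u => f u 0) (f' 0) s t ∧
      HasDerivWithinAt (fun u => f u 1) (f' 1) s t := by
  rw [hasDerivWithinAt_iff_hasFDerivWithinAt, hasFDerivWithinAt_euclidean, Fin.forall_fin_two]
  simp only [hasFDerivWithinAt_iff_hasDerivWithinAt]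
  simp

namespace IPMSM

/-- The trajectories of the motor with bounded current, speed and load and Lipschitz control. -/
structure Trajectory (M : IPMSM) (Vh B T ℓC : ℝ) where
  -- As a field rather than a parameter, the frequency is covered by every bound uniform over
  -- trajectories.
  ωh : ℝ
  TL : ℝ → ℝ
  vC : ℝ → Plane
  i : ℝ → Plane
  θ : ℝ → ℝ
  ω : ℝ → ℝ
  isSolution : M.IsSolution TL (fun t => vC t + injection Vh ωh t) i θ ω
  load_le : ∀ t : ℝ, 0 ≤ t → |TL t| ≤ T
  control_lip : ∀ s t : ℝ, 0 ≤ s → 0 ≤ t → ‖vC s - vC t‖ ≤ ℓC * |s - t|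
  state_le : ∀ t : ℝ, 0 ≤ t → ‖i t‖ ≤ B ∧ |ω t| ≤ B

namespace Trajectory

variable {M : IPMSM} {Vh B T ℓC : ℝ}

/-- Right-hand side of the first current equation, without the injection. -/
noncomputable def r0 (x : M.Trajectory Vh B T ℓC) (t : ℝ) : ℝ :=
  2 * M.np * M.L1 * (x.ω t * (Real.sin (2 * x.θ t) * x.i t 0 - Real.cos (2 * x.θ t) * x.i t 1))
    - M.Rs * x.i t 0 + M.np * M.Φ * (x.ω t * Real.sin (x.θ t)) + x.vC t 0

/-- Right-hand side of the second current equation, without the injection. -/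
noncomputable def r1 (x : M.Trajectory Vh B T ℓC) (t : ℝ) : ℝ :=
  2 * M.np * M.L1 * (x.ω t * (-(Real.cos (2 * x.θ t) * x.i t 0) - Real.sin (2 * x.θ t) * x.i t 1))
    - M.Rs * x.i t 1 - M.np * M.Φ * (x.ω t * Real.cos (x.θ t)) + x.vC t 1

/-- First component of `L(θ)⁻¹ (F + v^C)`. -/
noncomputable def g0 (x : M.Trajectory Vh B T ℓC) (t : ℝ) : ℝ :=
  1 / (M.Ld * M.Lq) * ((M.L0 - M.L1 * Real.cos (2 * x.θ t)) * x.r0 t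
    - M.L1 * Real.sin (2 * x.θ t) * x.r1 t)

/-- Second component of `L(θ)⁻¹ (F + v^C)`. -/
noncomputable def g1 (x : M.Trajectory Vh B T ℓC) (t : ℝ) : ℝ :=
  1 / (M.Ld * M.Lq) * ((M.L0 + M.L1 * Real.cos (2 * x.θ t)) * x.r1 t
    - M.L1 * Real.sin (2 * x.θ t) * x.r0 t)

theorem det_eq : M.L0 ^ 2 - M.L1 ^ 2 = M.Ld * M.Lq := by
  unfold IPMSM.L0 IPMSM.L1; ring

theorem current_eq (x : M.Trajectory Vh B T ℓC) {t : ℝ} (ht : 0 ≤ t) :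
    ∃ di : Plane, HasDerivWithinAt x.i di (Ici 0) t ∧
      (M.L0 + M.L1 * Real.cos (2 * x.θ t)) * di 0 + M.L1 * Real.sin (2 * x.θ t) * di 1
        = x.r0 t + Vh * Real.sin (x.ωh * t) ∧
      M.L1 * Real.sin (2 * x.θ t) * di 0 + (M.L0 - M.L1 * Real.cos (2 * x.θ t)) * di 1
        = x.r1 t := by
  obtain ⟨di, hdi, heq⟩ := (x.isSolution t ht).1
  refine ⟨di, hdi, ?_, ?_⟩
  · have h := congrArg (fun v : Plane => v 0) heq
    simp [act, IPMSM.L, Q, F, rot, injection] at h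
    unfold r0
    linear_combination h
  · have h := congrArg (fun v : Plane => v 1) heq
    simp [act, IPMSM.L, Q, F, rot, injection] at h
    unfold r1
    linear_combination h

/-- Cramer's rule: `L(θ)` has determinant `L₀² - L₁² = L_d L_q` for every `θ`. -/
theorem current_hasDeriv (x : M.Trajectory Vh B T ℓC) {t : ℝ} (ht : 0 ≤ t) :
    HasDerivWithinAt x.i ((!₂[x.g0 t, x.g1 t] : Plane)
      + (Vh * Real.sin (x.ωh * t)) • M.virtualOutput (x.θ t)) (Ici 0) t := by
  obtain ⟨di, hdi, h0, h1⟩ := x.current_eq ht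
  convert hdi using 1
  have hLd := M.Ld_pos
  have hLq := M.Lq_pos
  have hdet : M.L0 ^ 2 - M.L1 ^ 2 = M.Ld * M.Lq := det_eq
  have hcs := Real.sin_sq_add_cos_sq (2 * x.θ t)
  have hne : M.Ld * M.Lq ≠ 0 := by positivity
  have e0 : di 0 = x.g0 t + Vh * Real.sin (x.ωh * t) *
      (1 / (M.Ld * M.Lq) * (-M.L1 * Real.cos (2 * x.θ t) + M.L0)) := by
    unfold g0
    rw [← mul_right_inj' hne]
    have : M.Ld * M.Lq * (1 / (M.Ld * M.Lq)) = 1 := mul_one_div_cancel hne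
    generalize 1 / (M.Ld * M.Lq) = q at *
    linear_combination (-((M.L0 - M.L1 * Real.cos (2 * x.θ t)) * x.r0 t
      - M.L1 * Real.sin (2 * x.θ t) * x.r1 t) - Vh * Real.sin (x.ωh * t) *
        (-M.L1 * Real.cos (2 * x.θ t) + M.L0)) * this
      + (M.L0 - M.L1 * Real.cos (2 * x.θ t)) * h0 - M.L1 * Real.sin (2 * x.θ t) * h1
      - di 0 * hdet + M.L1 ^ 2 * di 0 * hcs
  have e1 : di 1 = x.g1 t + Vh * Real.sin (x.ωh * t) *
      (1 / (M.Ld * M.Lq) * (-M.L1 * Real.sin (2 * x.θ t))) := by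
    unfold g1
    rw [← mul_right_inj' hne]
    have : M.Ld * M.Lq * (1 / (M.Ld * M.Lq)) = 1 := mul_one_div_cancel hne
    generalize 1 / (M.Ld * M.Lq) = q at *
    linear_combination (-((M.L0 + M.L1 * Real.cos (2 * x.θ t)) * x.r1 t
      - M.L1 * Real.sin (2 * x.θ t) * x.r0 t) - Vh * Real.sin (x.ωh * t) *
        (-M.L1 * Real.sin (2 * x.θ t))) * this
      + (M.L0 + M.L1 * Real.cos (2 * x.θ t)) * h1 - M.L1 * Real.sin (2 * x.θ t) * h0
      - di 1 * hdet + M.L1 ^ 2 * di 1 * hcs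
  ext j
  fin_cases j
  · simp [virtualOutput, e0]
  · simp [virtualOutput, e1]

theorem bdd_current (j : Fin 2) :
    UnifBdd (fun (x : M.Trajectory Vh B T ℓC) t => x.i t j) :=
  ⟨B, fun x t ht => (Plane.abs_apply_le _ _).trans (x.state_le t ht).1⟩

theorem bdd_speed : UnifBdd (fun (x : M.Trajectory Vh B T ℓC) t => x.ω t) :=
  ⟨B, fun x t ht => (x.state_le t ht).2⟩

theorem bdd_load : UnifBdd (fun (x : M.Trajectory Vh B T ℓC) t => x.TL t) :=
  ⟨T, fun x t ht => x.load_le t ht⟩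

theorem lip_control (j : Fin 2) :
    UnifLip (fun (x : M.Trajectory Vh B T ℓC) t => x.vC t j) :=
  ⟨ℓC, fun x s t hs ht =>
    (Plane.abs_apply_le (x.vC s - x.vC t) j).trans (x.control_lip s t hs ht)⟩

/-- The angle may be unbounded, but it enters the equations only through sines and cosines, which
are bounded and vary at a rate controlled by the speed. -/
theorem lip_cos : UnifLip (fun (x : M.Trajectory Vh B T ℓC) t => Real.cos (x.θ t)) :=
  .of_deriv ((UnifBdd.sin _).neg.mul (bdd_speed.const_mul _))
    (fun x t ht => (x.isSolution t ht).2.1.cos)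

theorem lip_sin : UnifLip (fun (x : M.Trajectory Vh B T ℓC) t => Real.sin (x.θ t)) :=
  .of_deriv ((UnifBdd.cos _).mul (bdd_speed.const_mul _))
    (fun x t ht => (x.isSolution t ht).2.1.sin)

theorem lip_cos_two : UnifLip (fun (x : M.Trajectory Vh B T ℓC) t => Real.cos (2 * x.θ t)) :=
  .of_deriv ((UnifBdd.sin _).neg.mul ((bdd_speed.const_mul _).const_mul _))
    (fun x t ht => ((x.isSolution t ht).2.1.const_mul 2).cos)

theorem lip_sin_two : UnifLip (fun (x : M.Trajectory Vh B T ℓC) t => Real.sin (2 * x.θ t)) :=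
  .of_deriv ((UnifBdd.cos _).mul ((bdd_speed.const_mul _).const_mul _))
    (fun x t ht => ((x.isSolution t ht).2.1.const_mul 2).sin)

theorem lip_speed : UnifLip (fun (x : M.Trajectory Vh B T ℓC) t => x.ω t) := by
  refine .of_deriv (f' := fun x t => 1 / M.J * (M.np * M.Φ *
    (x.i t 1 * Real.cos (x.θ t) - x.i t 0 * Real.sin (x.θ t)) - M.f * x.ω t - x.TL t)) ?_ ?_
  · exact ((((((bdd_current 1).mul (.cos _)).sub ((bdd_current 0).mul (.sin _))).const_mul _).sub
      (bdd_speed.const_mul _)).sub bdd_load).const_mul _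
  · intro x t ht
    obtain ⟨dω, h, heq⟩ := (x.isSolution t ht).2.2
    rw [← heq, ← mul_assoc, one_div_mul_cancel M.J_pos.ne', one_mul]
    exact h

/-- Here `ψ` is the `α` component of the flux linkage `L(θ) i + Φ (cos θ, sin θ)`. Differentiating
`L(θ)` and the magnet flux cancels all speed terms of `F`, leaving `-R_s i + v`. -/
theorem bdd_control_zero : UnifBdd (fun (x : M.Trajectory Vh B T ℓC) t => x.vC t 0) := by
  refine UnifBdd.of_primitive
    (ψ := fun x t => (M.L0 + M.L1 * Real.cos (2 * x.θ t)) * x.i t 0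
      + M.L1 * Real.sin (2 * x.θ t) * x.i t 1 + M.Φ * Real.cos (x.θ t))
    (a := fun x t => -(M.Rs * x.i t 0) + Vh * Real.sin (x.ωh * t))
    ((((UnifBdd.const _).add ((UnifBdd.cos _).const_mul _)).mul (bdd_current 0)).add
      (((UnifBdd.sin _).const_mul _).mul (bdd_current 1)) |>.add ((UnifBdd.cos _).const_mul _))
    (((bdd_current 0).const_mul _).neg.add ((UnifBdd.sin _).const_mul _)) (lip_control 0) ?_
  intro x t ht
  obtain ⟨di, hdi, h0, -⟩ := x.current_eq ht
  have hθ := (x.isSolution t ht).2.1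
  have hi := Plane.hasDerivWithinAt_iff.1 hdi
  refine HasDerivWithinAt.congr_deriv (((((((hθ.const_mul 2).cos.const_mul M.L1).const_add
    M.L0).mul hi.1).add (((hθ.const_mul 2).sin.const_mul M.L1).mul hi.2))).add
    (hθ.cos.const_mul M.Φ)) ?_
  unfold r0 at h0
  linear_combination h0

theorem bdd_control_one : UnifBdd (fun (x : M.Trajectory Vh B T ℓC) t => x.vC t 1) := by
  refine UnifBdd.of_primitive
    (ψ := fun x t => M.L1 * Real.sin (2 * x.θ t) * x.i t 0
      + (M.L0 - M.L1 * Real.cos (2 * x.θ t)) * x.i t 1 + M.Φ * Real.sin (x.θ t))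
    (a := fun x t => -(M.Rs * x.i t 1))
    ((((UnifBdd.sin _).const_mul _).mul (bdd_current 0)).add
      (((UnifBdd.const _).sub ((UnifBdd.cos _).const_mul _)).mul (bdd_current 1)) |>.add
      ((UnifBdd.sin _).const_mul _))
    ((bdd_current 1).const_mul _).neg (lip_control 1) ?_
  intro x t ht
  obtain ⟨di, hdi, -, h1⟩ := x.current_eq ht
  have hθ := (x.isSolution t ht).2.1
  have hi := Plane.hasDerivWithinAt_iff.1 hdi
  refine HasDerivWithinAt.congr_deriv ((((((hθ.const_mul 2).sin.const_mul M.L1).mul hi.1).add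
    ((((hθ.const_mul 2).cos.const_mul M.L1).const_sub M.L0).mul hi.2))).add
    (hθ.sin.const_mul M.Φ)) ?_
  unfold r1 at h1
  linear_combination h1

theorem bdd_r0 : UnifBdd (r0 : M.Trajectory Vh B T ℓC → ℝ → ℝ) :=
  (((bdd_speed.mul (((UnifBdd.sin _).mul (bdd_current 0)).sub
    ((UnifBdd.cos _).mul (bdd_current 1)))).const_mul _).sub
    ((bdd_current 0).const_mul _) |>.add ((bdd_speed.mul (.sin _)).const_mul _)).add
    bdd_control_zero

theorem bdd_r1 : UnifBdd (r1 : M.Trajectory Vh B T ℓC → ℝ → ℝ) :=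
  (((bdd_speed.mul (((UnifBdd.cos _).mul (bdd_current 0)).neg.sub
    ((UnifBdd.sin _).mul (bdd_current 1)))).const_mul _).sub
    ((bdd_current 1).const_mul _) |>.sub ((bdd_speed.mul (.cos _)).const_mul _)).add
    bdd_control_one

theorem bdd_g0 : UnifBdd (g0 : M.Trajectory Vh B T ℓC → ℝ → ℝ) :=
  ((((UnifBdd.const _).sub ((UnifBdd.cos _).const_mul _)).mul bdd_r0).sub
    (((UnifBdd.sin _).const_mul _).mul bdd_r1)).const_mul _

theorem bdd_g1 : UnifBdd (g1 : M.Trajectory Vh B T ℓC → ℝ → ℝ) :=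
  ((((UnifBdd.const _).add ((UnifBdd.cos _).const_mul _)).mul bdd_r1).sub
    (((UnifBdd.sin _).const_mul _).mul bdd_r0)).const_mul _

/-- The injection oscillates ever faster as `ω_h` grows, but its amplitude `V_h` is fixed, so the
current derivative stays bounded. -/
theorem lip_current_zero : UnifLip (fun (x : M.Trajectory Vh B T ℓC) t => x.i t 0) :=
  .of_deriv (f' := fun x t => x.g0 t + Vh * Real.sin (x.ωh * t) *
      (1 / (M.Ld * M.Lq) * (-M.L1 * Real.cos (2 * x.θ t) + M.L0)))
    (bdd_g0.add (((UnifBdd.sin _).const_mul _).mul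
      ((((UnifBdd.cos _).const_mul _).add (.const _)).const_mul _)))
    (fun x t ht => by
      simpa [virtualOutput] using (Plane.hasDerivWithinAt_iff.1 (x.current_hasDeriv ht)).1)

theorem lip_current_one : UnifLip (fun (x : M.Trajectory Vh B T ℓC) t => x.i t 1) :=
  .of_deriv (f' := fun x t => x.g1 t + Vh * Real.sin (x.ωh * t) *
      (1 / (M.Ld * M.Lq) * (-M.L1 * Real.sin (2 * x.θ t))))
    (bdd_g1.add (((UnifBdd.sin _).const_mul _).mul
      (((UnifBdd.sin _).const_mul _).const_mul _)))
    (fun x t ht => by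
      simpa [virtualOutput] using (Plane.hasDerivWithinAt_iff.1 (x.current_hasDeriv ht)).2)

theorem lip_r0 : UnifLip (r0 : M.Trajectory Vh B T ℓC → ℝ → ℝ) :=
  (((lip_speed.mul ((lip_sin_two.mul lip_current_zero (.sin _) (bdd_current 0)).sub
      (lip_cos_two.mul lip_current_one (.cos _) (bdd_current 1))) bdd_speed
      (((UnifBdd.sin _).mul (bdd_current 0)).sub ((UnifBdd.cos _).mul (bdd_current 1)))).const_mul
      _).sub (lip_current_zero.const_mul _) |>.add
    ((lip_speed.mul lip_sin bdd_speed (.sin _)).const_mul _)).add (lip_control 0)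

theorem lip_r1 : UnifLip (r1 : M.Trajectory Vh B T ℓC → ℝ → ℝ) :=
  (((lip_speed.mul ((lip_cos_two.mul lip_current_zero (.cos _) (bdd_current 0)).neg.sub
      (lip_sin_two.mul lip_current_one (.sin _) (bdd_current 1))) bdd_speed
      (((UnifBdd.cos _).mul (bdd_current 0)).neg.sub
        ((UnifBdd.sin _).mul (bdd_current 1)))).const_mul
      _).sub (lip_current_one.const_mul _) |>.sub
    ((lip_speed.mul lip_cos bdd_speed (.cos _)).const_mul _)).add (lip_control 1)

theorem lip_g0 : UnifLip (g0 : M.Trajectory Vh B T ℓC → ℝ → ℝ) :=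
  ((((UnifLip.const _).sub (lip_cos_two.const_mul _)).mul lip_r0
      ((UnifBdd.const _).sub ((UnifBdd.cos _).const_mul _)) bdd_r0).sub
    ((lip_sin_two.const_mul _).mul lip_r1 ((UnifBdd.sin _).const_mul _) bdd_r1)).const_mul _

theorem lip_g1 : UnifLip (g1 : M.Trajectory Vh B T ℓC → ℝ → ℝ) :=
  ((((UnifLip.const _).add (lip_cos_two.const_mul _)).mul lip_r1
      ((UnifBdd.const _).add ((UnifBdd.cos _).const_mul _)) bdd_r1).sub
    ((lip_sin_two.const_mul _).mul lip_r0 ((UnifBdd.sin _).const_mul _) bdd_r0)).const_mul _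

/-- The current derivative without the injected part is Lipschitz, uniformly over all
trajectories and injection frequencies. -/
theorem exists_drift_lipschitz (M : IPMSM) (Vh B T ℓC : ℝ) :
    ∃ k : ℝ, 0 ≤ k ∧ ∀ (x : M.Trajectory Vh B T ℓC) (s t : ℝ), 0 ≤ s → 0 ≤ t →
      ‖(!₂[x.g0 s, x.g1 s] : Plane) - !₂[x.g0 t, x.g1 t]‖ ≤ k * |s - t| := by
  obtain ⟨a, ha⟩ := lip_g0 (M := M) (Vh := Vh) (B := B) (T := T) (ℓC := ℓC)
  obtain ⟨b, hb⟩ := lip_g1 (M := M) (Vh := Vh) (B := B) (T := T) (ℓC := ℓC)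
  refine ⟨|a| + |b|, by positivity, fun x s t hs ht => ?_⟩
  have h1 := (ha x s t hs ht).trans
    (mul_le_mul_of_nonneg_right (le_abs_self a) (abs_nonneg (s - t)))
  have h2 := (hb x s t hs ht).trans
    (mul_le_mul_of_nonneg_right (le_abs_self b) (abs_nonneg (s - t)))
  rw [add_mul]
  exact (Plane.norm_le _).trans (add_le_add (by simpa using h1) (by simpa using h2))

end Trajectory

end IPMSM

/-! ### Assembling the estimate -/

theorem proposition2 (M : IPMSM) (Vh : ℝ) (hVh : 0 < Vh) (B T ℓv ℓC : ℝ) :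
    ∃ ωstar : ℝ, 0 < ωstar ∧ ∃ γstar : ℝ, 0 < γstar ∧ ∃ C : ℝ → ℝ, Monotone C ∧
      ∀ ωh : ℝ, ωstar < ωh → ∀ γ : ℝ, γstar / injPeriod ωh < γ →
      ∀ (TL : ℝ → ℝ) (vC i : ℝ → Plane) (θ ω : ℝ → ℝ),
        M.IsSolution TL (fun t => vC t + injection Vh ωh t) i θ ω →
        (∀ t : ℝ, 0 ≤ t → |TL t| ≤ T) →
        (∀ s t : ℝ, 0 ≤ s → 0 ≤ t → ‖vC s - vC t‖ ≤ ℓC * |s - t|) →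
        (∀ t : ℝ, 0 ≤ t → ‖i t‖ ≤ B ∧ |ω t| ≤ B) →
        (∀ t : ℝ, 0 ≤ t →
          ‖derivWithin (fun s => M.virtualOutput (θ s)) (Set.Ici 0) t‖ ≤ ℓv) →
        ∀ (t₀ : ℝ) (yhat : ℝ → Plane),
          IsGradOutput Vh ωh γ t₀ (filterG (injPeriod ωh) i) yhat →
          Filter.limsup (fun t => ‖yhat t - M.virtualOutput (θ t)‖ₑ) Filter.atTop
              ≤ ENNReal.ofReal (C (γ * injPeriod ωh) * injPeriod ωh) ∧
          (M.Ld < M.Lq →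
            Filter.limsup
                (fun t => ‖((M.angleOf (yhat t) - θ t : ℝ) : AddCircle Real.pi)‖ₑ)
                Filter.atTop
              ≤ ENNReal.ofReal (C (γ * injPeriod ωh) * injPeriod ωh)) := by
  obtain ⟨k, hk, hdrift⟩ := IPMSM.Trajectory.exists_drift_lipschitz M Vh B T ℓC
  set σ := Vh / (2 * Real.pi) with hσ
  have hσ0 : 0 < σ := by positivity
  set K := k + Vh * |ℓv| + σ * |ℓv| with hK
  -- One constant for both conclusions: `1` serves the output, the other entry is the Lipschitz
  -- constant of the angle. The maximum keeps `D` positive when `L_d < L_q` fails.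
  set D := max 1 (Real.pi / (2 * (-M.L1 / (M.Ld * M.Lq)))) with hD
  have hD1 : 1 ≤ D := le_max_left _ _
  have hD0 : 0 < D := one_pos.trans_le hD1
  have hL0 : 0 ≤ 2 / σ ^ 2 * (σ * K + |ℓv|) := by positivity
  refine ⟨1, one_pos, 1, one_pos,
    fun m => D * (Real.exp (m * σ ^ 2 / (4 * Real.pi)) * (2 / σ ^ 2 * (σ * K + |ℓv|))), ?_, ?_⟩
  · intro a b hab
    dsimp only
    gcongr
  intro ωh hωh γ hγ TL vC i θ ω hsol hT hvC hst hyv t₀ yhat hgrad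
  have hω : 0 < ωh := one_pos.trans hωh
  have hε : 0 < injPeriod ωh := injPeriod_pos hω
  have hγ0 : 0 < γ := (by positivity : (0 : ℝ) < 1 / injPeriod ωh).trans hγ
  let x : M.Trajectory Vh B T ℓC := ⟨ωh, TL, vC, i, θ, ω, hsol, hT, hvC, hst⟩
  -- The assumed bound on `derivWithin` is informative only once differentiability is known.
  have hdiff : DifferentiableOn ℝ (fun s => M.virtualOutput (θ s)) (Ici 0) := by
    intro t ht
    have hθ := (hsol t ht).2.1
    exact (Plane.hasDerivWithinAt_iff (f := fun s => M.virtualOutput (θ s))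
      (f' := !₂[1 / (M.Ld * M.Lq) * (-M.L1 * (-Real.sin (2 * θ t) * (2 * (M.np * ω t)))),
        1 / (M.Ld * M.Lq) * (-M.L1 * (Real.cos (2 * θ t) * (2 * (M.np * ω t))))]).2
      ⟨by simpa [IPMSM.virtualOutput] using
          ((((hθ.const_mul 2).cos.const_mul (-M.L1)).add_const M.L0).const_mul
            (1 / (M.Ld * M.Lq))),
        by simpa [IPMSM.virtualOutput] using
          (((hθ.const_mul 2).sin.const_mul (-M.L1)).const_mul
            (1 / (M.Ld * M.Lq)))⟩).differentiableWithinAt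
  have hyd : ∀ t, 0 < t → HasDerivAt (fun s => M.virtualOutput (θ s))
      (derivWithin (fun s => M.virtualOutput (θ s)) (Ici 0) t) t := fun t ht =>
    (hdiff t ht.le).hasDerivWithinAt.hasDerivAt (Ici_mem_nhds ht)
  have hyl : ∀ s t : ℝ, 0 ≤ s → 0 ≤ t →
      ‖M.virtualOutput (θ s) - M.virtualOutput (θ t)‖ ≤ |ℓv| * |s - t| := fun s t hs ht =>
    (convex_Ici (0 : ℝ)).norm_image_sub_le_of_norm_derivWithin_le hdiff
      (fun u hu => (hyv u hu).trans (le_abs_self _)) ht hs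
  have hfilter : ∀ t, 2 * injPeriod ωh ≤ t →
      ‖filterG (injPeriod ωh) i t - (injPeriod ωh * sigS Vh ωh t) • M.virtualOutput (θ t)‖
        ≤ K * injPeriod ωh ^ 2 := fun t ht =>
    norm_filterG_sub_le (y := fun t => M.virtualOutput (θ t)) hVh.le hω
      (fun t ht => x.current_hasDeriv ht) hk (abs_nonneg _) (hdrift x) hyl ht
  obtain ⟨z, hz⟩ := hgrad
  -- From `t₁` on the estimator is running and the filter window lies in `[0, ∞)`.
  set t₁ := max (t₀ + 1) (2 * injPeriod ωh) with ht₁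
  have h0 : ∀ t, t₁ ≤ t → t₀ < t := fun t ht => by
    linarith [le_max_left (t₀ + 1) (2 * injPeriod ωh)]
  have h2 : ∀ t, t₁ ≤ t → 2 * injPeriod ωh ≤ t := fun t ht => (le_max_right _ _).trans ht
  have hpos : ∀ t, t₁ ≤ t → 0 < t := fun t ht => by linarith [h2 t ht]
  obtain ⟨c, r, hr, hest⟩ := gradient_estimate (t₁ := t₁) (ℓ := |ℓv|) (K := K) hVh hω hγ0
    (fun t ht => (hz t (h0 t ht)).1) (fun t ht => hyd t (hpos t ht))
    (fun t ht => (hyv t (hpos t ht).le).trans (le_abs_self _)) (fun t ht => hfilter t (h2 t ht))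
  have hbound : ∀ t, t₁ ≤ t → ‖yhat t - M.virtualOutput (θ t)‖ ≤ c * Real.exp (-(r * t))
      + Real.exp (γ * injPeriod ωh * σ ^ 2 / (4 * Real.pi)) * (2 / σ ^ 2 * (σ * K + |ℓv|))
        * injPeriod ωh := by
    intro t ht
    rw [(hz t (h0 t ht)).2]
    refine (hest t ht).trans (add_le_add le_rfl ?_)
    -- The only use of the size of the gain: `γε > 1` makes the drift term `O(ε)`.
    have hγinv : |ℓv| / γ ≤ |ℓv| * injPeriod ωh := by
      rw [div_le_iff₀ hγ0, mul_assoc]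
      refine le_mul_of_one_le_right (abs_nonneg _) ?_
      rw [div_lt_iff₀ hε] at hγ
      linarith
    calc _ ≤ Real.exp (γ * injPeriod ωh * σ ^ 2 / (4 * Real.pi)) *
          (2 / σ ^ 2 * (σ * K * injPeriod ωh + |ℓv| * injPeriod ωh)) := by gcongr
      _ = _ := by ring
  constructor
  · refine (limsup_enorm_le_of_exp hr hbound).trans (ENNReal.ofReal_le_ofReal ?_)
    gcongr
    exact le_mul_of_one_le_left (by positivity) hD1
  · intro hL
    refine (limsup_enorm_le_of_exp (c := D * c) (t₁ := t₁) hr fun t ht => ?_)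
    calc _ ≤ Real.pi / (2 * (-M.L1 / (M.Ld * M.Lq))) * ‖yhat t - M.virtualOutput (θ t)‖ :=
          M.norm_angleOf_sub_le hL _ _
      _ ≤ D * ‖yhat t - M.virtualOutput (θ t)‖ := by
          gcongr
          exact le_max_right _ _
      _ ≤ D * _ := mul_le_mul_of_nonneg_left (hbound t ht) hD0.le
      _ = _ := by ring
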